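/- Let $K$ be a simplicial complex on the label set $[m]=\{1,\dots,m\}$ (it contains $\varnothing$; labels $i$ with $\{i\}\notin K$ are allowed), $K\ne\Delta_{[m]}$, and let $\widehat K=\{I\subseteq[m] : [m]\setminus I\notin K\}$ be its Alexander dual. Let $d\ge 0$. For a $d$-dimensional convex polytope $P=\mathrm{conv}\{y_1,\dots,y_m\}\subset\mathbb R^d$ with (distinct) vertices $y_1,\dots,y_m$, the nerve-complex $K(P)$ is the complex on $[m]$ whose simplices are the sets $I$ such that all $y_i$, $i\in I$, lie in a common facet of $P$; the facets are the faces of dimension $d-1$, where $\dim\varnothing=-1$. A Gale diagram $G(P)=(g_1,\dots,g_m)\subset\mathbb S^{m-2-d}\sqcup\{0\}\subset\mathbb R^{m-1-d}$ of $P$ is obtained as follows: choose a basis of the $(m-1-d)$-dimensional space of affine dependences $\{a\in\mathbb R^m:\sum a_i=0,\ \sum a_iy_i=0\}$, write the basis vectors as the columns of a matrix, and scale its nonzero rows to unit length; $g_i$ is the resulting $i$-th row. For a configuration $X=(x_1,\dots,x_m)$ of points of $\mathbb S^{r}\sqcup\{0\}\subset\mathbb R^{r+1}$ (repetitions allowed,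 $r\ge -1$, $\mathbb S^{-1}=\varnothing$), put $H(x)=\{y\in\mathbb S^r:\langle x,y\rangle>0\}$. The constellation complex $\Delta(X)$ is the complex on $[m]$ consisting of $\varnothing$ and all nonempty $I$ with $\bigcap_{i\in I}H(x_i)\neq\varnothing$. $X$ is good if every point of $\mathbb S^r$ lies in $H(x_i)$ for at least two indices $i$, and nondegenerate if for every $J\subseteq[m]$ with $0\in\mathrm{conv}\{x_i\}_{i\in J}$ the points $x_i$, $i\in J$, span $\mathbb R^{r+1}$. 1. $K$ is isomorphic (by a bijection of $[m]$) to $K(P)$ for some $d$-dimensional polytope $P$ with $m$ vertices if and only if $m\ge d+1$ and $\widehat K=\Delta(X)$ for some good configuration $X\subset\mathbb S^{m-2-d}\sqcup\{0\}$ of $m$ points. Such $X$ are the Gale diagrams of such polytopes: every $P$ as above has a Gale diagram, and if $\sigma$ is an isomorphism $K\to K(P)$ and $G(P)=(g_i)$ is any Gale diagram of $P$, then $X=(g_{\sigma(i)})_{i\in[m]}$ is a good configuration with $\widehat K=\Delta(X)$; conversely, every good configuration $X\subset\mathbb S^{m-2-d}\sqcup\{0\}$ with $\widehat K=\Delta(X)$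 is a Gale diagram of some $d$-dimensional polytope $P$ with vertices labelled by $[m]$ and $K(P)=K$. 2. $K$ is isomorphic to the boundary complex of a simplicial $d$-dimensional polytope with $m$ vertices if and only if $m\ge d+1$ and $\widehat K=\Delta(X)$ for some good nondegenerate configuration $X$ of $m$ points, where $X\subset\mathbb S^{m-2-d}$ if $m\ge d+2$, and $X=(0,\dots,0)\subset\mathbb R^0$ if $m=d+1$. -/

import Mathlib

/-- A simplicial complex on the set of labels `[m]`. The empty simplex always belongs to it;
labels `i` with `{i}` not in the complex (ghost vertices) are allowed. -/
@[ext]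
structure LabelComplex (m : ℕ) where
  faces : Set (Finset (Fin m))
  empty_mem : ∅ ∈ faces
  down_closed : ∀ {I J : Finset (Fin m)}, I ∈ faces → J ⊆ I → J ∈ faces

/-- The (combinatorial) Alexander dual of a complex `K` on `[m]` which is not the full simplex:
its simplices are the sets whose complement is not a simplex of `K`. -/
def LabelComplex.dual {m : ℕ} (K : LabelComplex m) (hK : Finset.univ ∉ K.faces) :
    LabelComplex m where
  faces := {I | Iᶜ ∉ K.faces}
  empty_mem := by simpa using hK
  down_closed := fun {_ _} hI hJI hJ =>
    hI (K.down_closed hJ (Finset.compl_subset_compl.mpr hJI))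

/-- The bijection `σ` of the labels carries the family `A` of simplices onto the family `B`. -/
def IsFaceIso {m : ℕ} (σ : Equiv.Perm (Fin m)) (A B : Set (Finset (Fin m))) : Prop :=
  ∀ I : Finset (Fin m), I ∈ A ↔ I.map σ.toEmbedding ∈ B

/-- The dimension of (the affine hull of) a set, with `dim ∅ = -1`. -/
noncomputable def hullDim {E : Type*} [AddCommGroup E] [Module ℝ E] (F : Set E) : ℤ :=
  open Classical in if F = ∅ then -1 else (Module.finrank ℝ (vectorSpan ℝ F) : ℤ)

/-- A convex polytope of dimension `d` in `ℝ^d`, the convex hull of its vertices, which are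
`m` distinct points labelled by `[m]`. -/
structure LabeledPolytope (d m : ℕ) where
  vertex : Fin m → EuclideanSpace ℝ (Fin d)
  injective : Function.Injective vertex
  range_eq : Set.range vertex = (convexHull ℝ (Set.range vertex)).extremePoints ℝ
  dim_eq : hullDim (convexHull ℝ (Set.range vertex)) = d

namespace LabeledPolytope

variable {d m : ℕ} (P : LabeledPolytope d m)

/-- The polytope itself, as a set of points. -/
def carrier : Set (EuclideanSpace ℝ (Fin d)) := convexHull ℝ (Set.range P.vertex)

/-- A proper face: the empty set, or the set of maximizers of a linear functional on `P`,
different from `P`. -/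
def IsProperFace (F : Set (EuclideanSpace ℝ (Fin d))) : Prop :=
  IsExposed ℝ P.carrier F ∧ F ≠ P.carrier

/-- A facet: a proper face of dimension `d - 1`. -/
def IsFacet (F : Set (EuclideanSpace ℝ (Fin d))) : Prop :=
  P.IsProperFace F ∧ hullDim F = (d : ℤ) - 1

/-- The nerve-complex `K(P)`: sets of labels whose vertices belong to a common facet.
(A polytope has a facet, so the empty set would belong to it anyway.) -/
def nerveComplex : LabelComplex m where
  faces := {I | I = ∅ ∨ ∃ F, P.IsFacet F ∧ ∀ i ∈ I, P.vertex i ∈ F}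
  empty_mem := Or.inl rfl
  down_closed := by
    rintro I J (rfl | ⟨F, hF, h⟩) hJ
    · exact Or.inl (Finset.subset_empty.mp hJ)
    · exact Or.inr ⟨F, hF, fun i hi => h i (hJ hi)⟩

/-- A polytope is simplicial if all its facets are simplices, that is, the vertices lying in a
facet are affinely independent. -/
def IsSimplicial : Prop :=
  ∀ F, P.IsFacet F →
    AffineIndependent ℝ (fun i : {i : Fin m // P.vertex i ∈ F} => P.vertex i)

/-- The simplices of the boundary complex `∂P` (of a simplicial polytope): sets of labels whose
vertices span a proper face, the empty face included. -/
def boundaryFaces : Set (Finset (Fin m)) :=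
  {I | P.IsProperFace (convexHull ℝ (P.vertex '' (I : Set (Fin m))))}

end LabeledPolytope

/-- The space of affine dependences of a sequence of points. -/
def affineDependences {d m : ℕ} (y : Fin m → EuclideanSpace ℝ (Fin d)) :
    Submodule ℝ (Fin m → ℝ) where
  carrier := {a | ∑ i, a i = 0 ∧ ∑ i, a i • y i = 0}
  zero_mem' := by simp
  add_mem' := by
    rintro a b ⟨ha, ha'⟩ ⟨hb, hb'⟩
    exact ⟨by simp [Finset.sum_add_distrib, ha, hb],
      by simp [add_smul, Finset.sum_add_distrib, ha', hb']⟩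
  smul_mem' := by
    rintro c a ⟨ha, ha'⟩
    exact ⟨by simp [← Finset.mul_sum, ha], by simp [mul_smul, ← Finset.smul_sum, ha']⟩

/-- `g` is a Gale transform of `y`: for some basis of the space of affine dependences of `y`,
`g i` is the `i`-th row of the matrix whose columns are the basis vectors. -/
def IsGaleTransform {d m n : ℕ} (y : Fin m → EuclideanSpace ℝ (Fin d))
    (g : Fin m → EuclideanSpace ℝ (Fin n)) : Prop :=
  ∃ b : Module.Basis (Fin n) ℝ (affineDependences y),
    ∀ i j, g i j = (b j : Fin m → ℝ) i

/-- `X` is an (affine) Gale diagram of `y`: it is obtained from a Gale transform of `y` by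
normalizing the nonzero vectors to unit length. -/
def IsGaleDiagram {d m n : ℕ} (y : Fin m → EuclideanSpace ℝ (Fin d))
    (X : Fin m → EuclideanSpace ℝ (Fin n)) : Prop :=
  ∃ g : Fin m → EuclideanSpace ℝ (Fin n),
    IsGaleTransform y g ∧ ∀ i, X i = NormedSpace.normalize (g i)

/-- `X` is a configuration of `m` points of `𝕊^(n-1) ⊔ {0} ⊆ ℝ^n`, repetitions allowed. -/
def IsConfiguration {m n : ℕ} (X : Fin m → EuclideanSpace ℝ (Fin n)) : Prop :=
  ∀ i, X i ∈ Metric.sphere (0 : EuclideanSpace ℝ (Fin n)) 1 ∨ X i = 0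

/-- The open hemisphere `H(x)` of the unit sphere; it is empty for `x = 0`. -/
def hemisphere {n : ℕ} (x : EuclideanSpace ℝ (Fin n)) : Set (EuclideanSpace ℝ (Fin n)) :=
  {y | y ∈ Metric.sphere (0 : EuclideanSpace ℝ (Fin n)) 1 ∧ 0 < inner ℝ x y}

/-- The constellation complex `Δ(X)`: the nerve of the family of hemispheres `H(x_i)`.
(The intersection over `I = ∅` is the whole space, so the empty simplex belongs to it.) -/
def constellationComplex {m n : ℕ} (X : Fin m → EuclideanSpace ℝ (Fin n)) : LabelComplex m where
  faces := {I | (⋂ i ∈ I, hemisphere (X i)).Nonempty}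
  empty_mem := by simp
  down_closed := fun {_ _} ⟨y, hy⟩ hJ =>
    ⟨y, Set.biInter_subset_biInter_left (fun _ hi => hJ hi) hy⟩

/-- `X` is good: every point of the sphere lies in at least two of the hemispheres `H(x_i)`. -/
def IsGood {m n : ℕ} (X : Fin m → EuclideanSpace ℝ (Fin n)) : Prop :=
  ∀ y ∈ Metric.sphere (0 : EuclideanSpace ℝ (Fin n)) 1, 2 ≤ {i | y ∈ hemisphere (X i)}.ncard

/-- `X` is nondegenerate: any subfamily with `0` in its convex hull spans the whole space. -/
def IsNondegenerate {m n : ℕ} (X : Fin m → EuclideanSpace ℝ (Fin n)) : Prop :=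
  ∀ J : Set (Fin m), 0 ∈ convexHull ℝ (X '' J) → Submodule.span ℝ (X '' J) = ⊤

/-! Everything is read off from one subspace of `ℝ^m`: the space `A` of affine dependences of the
vertices. Its orthogonal complement consists of the values of affine functions at the vertices
(`perp_affineDependences`). A Gale diagram parametrizes `A` up to positive factors (`Represents`):
the vectors of `A` have coordinates `s i * ⟪X i, w⟫`. Hence every condition on `X` or on `P` becomes
a sign condition on `A`.

A set is in `Δ(X)` iff some `a ∈ A` is positive on it. A set `I` is in `K(P)` iff a nonzero
nonnegative vector of `perp A` vanishes on `I`; by Gordan's alternative, iff no `a ∈ A` is positive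
off `I`. Thus the two complexes are Alexander dual. Both goodness of `X` and the `y i` being
distinct vertices say that a nonzero `a ∈ A` has at least two positive coordinates. Simpliciality
and nondegeneracy correspond on complementary index sets.

For the converse, goodness and Stiemke's alternative give `s i > 0` with `∑ s i • X i = 0`. After
rescaling, the represented subspace is orthogonal to the constants, so its complement is the space
of affine functions on suitable points of `ℝ^d` (`IsGood.exists_represents`). -/

/-! ### Theorems of the alternative for subspaces of `ℝ^ι`. -/

section Alternatives

/-- The subspace of vectors vanishing on `I`. -/
def vanishingOn {ι : Type*} (I : Set ι) : Submodule ℝ (ι → ℝ) where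
  carrier := {a | ∀ i ∈ I, a i = 0}
  zero_mem' := fun _ _ => rfl
  add_mem' := fun ha hb i hi => by simp [ha i hi, hb i hi]
  smul_mem' := fun c a ha i hi => by simp [ha i hi]

theorem mem_vanishingOn {ι : Type*} {I : Set ι} {a : ι → ℝ} : a ∈ vanishingOn I ↔ ∀ i ∈ I, a i = 0 :=
  Iff.rfl

variable {ι : Type*} [Fintype ι]

/-- The orthogonal complement of a subspace of `ℝ^ι` with respect to the dot product. -/
def perp (W : Submodule ℝ (ι → ℝ)) : Submodule ℝ (ι → ℝ) :=
  LinearMap.BilinForm.orthogonal (dotProductBilin ℝ ℝ) W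

theorem mem_perp {W : Submodule ℝ (ι → ℝ)} {c : ι → ℝ} :
    c ∈ perp W ↔ ∀ a ∈ W, ∑ i, a i * c i = 0 := by
  simp [perp, LinearMap.BilinForm.mem_orthogonal_iff, dotProduct]

theorem dotProductBilin_isRefl :
    LinearMap.BilinForm.IsRefl (dotProductBilin ℝ ℝ : LinearMap.BilinForm ℝ (ι → ℝ)) := by
  intro a b h
  simpa [dotProduct_comm] using h

theorem dotProductBilin_nondegenerate :
    LinearMap.BilinForm.Nondegenerate (dotProductBilin ℝ ℝ : LinearMap.BilinForm ℝ (ι → ℝ)) := by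
  refine (dotProductBilin_isRefl (ι := ι)).nondegenerate_iff_separatingLeft.mpr fun a h => ?_
  exact dotProduct_self_eq_zero.mp (h a)

theorem perp_perp (W : Submodule ℝ (ι → ℝ)) : perp (perp W) = W :=
  LinearMap.BilinForm.orthogonal_orthogonal dotProductBilin_nondegenerate
    dotProductBilin_isRefl W

theorem finrank_add_finrank_perp (W : Submodule ℝ (ι → ℝ)) :
    Module.finrank ℝ W + Module.finrank ℝ (perp W) = Fintype.card ι := by
  have h := LinearMap.BilinForm.finrank_orthogonal
    (dotProductBilin_nondegenerate (ι := ι)) W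
  have h1 := Submodule.finrank_le W
  rw [Module.finrank_fintype_fun_eq_card] at h h1
  unfold perp
  omega

/-- Gordan's alternative: if no vector of a subspace is positive on `I`, then its orthogonal
complement contains a nonzero nonnegative vector supported on `I`. -/
theorem exists_nonneg_mem_perp (C : Submodule ℝ (ι → ℝ)) (I : Set ι)
    (h : ¬ ∃ c ∈ C, ∀ i ∈ I, 0 < c i) :
    ∃ a ∈ perp C, (∀ i, 0 ≤ a i) ∧ a ≠ 0 ∧ ∀ i ∉ I, a i = 0 := by
  classical
  by_contra hno
  apply h
  -- Normalizing by coordinate sum 1 makes the forbidden vectors a compact convex set, which can be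
  -- strictly separated from `perp C`.
  set S : Set (ι → ℝ) := stdSimplex ℝ ι ∩ {a | ∀ i ∉ I, a i = 0} with hS
  have hSc : Convex ℝ S := by
    refine (convex_stdSimplex ℝ ι).inter fun a ha b hb s t _ _ _ i hi => ?_
    simp [ha i hi, hb i hi]
  have hScomp : IsCompact S := by
    refine (isCompact_stdSimplex ℝ ι).inter_right ?_
    simp only [Set.ofPred_forall]
    exact isClosed_iInter fun i => isClosed_iInter fun _ =>
      isClosed_eq (continuous_apply i) continuous_const
  have hdisj : Disjoint S (perp C : Set (ι → ℝ)) := by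
    rw [Set.disjoint_left]
    rintro a ⟨⟨ha0, ha1⟩, haI⟩ haC
    refine hno ⟨a, haC, ha0, ?_, haI⟩
    rintro rfl
    simp at ha1
  obtain ⟨f, u, v, hfu, huv, hfv⟩ := geometric_hahn_banach_compact_closed hSc hScomp
    (perp C).convex (Submodule.closed_of_finiteDimensional (perp C)) hdisj
  have hv : v < 0 := by simpa using hfv 0 (perp C).zero_mem
  -- A linear functional bounded below on a subspace vanishes there: otherwise some multiple of `b`
  -- attains the excluded value `v`.
  have hf0 : ∀ b ∈ perp C, f b = 0 := by
    intro b hb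
    by_contra hne
    have := hfv ((v / f b) • b) ((perp C).smul_mem _ hb)
    rw [map_smul, smul_eq_mul, div_mul_cancel₀ _ hne] at this
    exact lt_irrefl _ this
  have hf : ∀ a, f a = ∑ i, a i * f (Pi.single i 1) := fun a => by
    conv_lhs => rw [pi_eq_sum_univ' a]
    simp [map_sum]
  -- The coefficient vector of `-f` lies in `perp (perp C) = C`; on `I` it is positive since `f < u
  -- < v < 0` at the unit vectors of `S`.
  refine ⟨fun i => - f (Pi.single i 1), ?_, fun i hi => ?_⟩
  · rw [← perp_perp C, mem_perp]
    intro b hb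
    have := hf0 b hb
    rw [hf] at this
    simp [this]
  · have : f (Pi.single i 1) < u := hfu _ ⟨single_mem_stdSimplex ℝ i, fun j hj => by
      simp [show j ≠ i from fun e => hj (e ▸ hi)]⟩
    linarith

/-- The two options in Gordan's alternative exclude each other. -/
theorem not_exists_pos_of_nonneg_mem_perp {C : Submodule ℝ (ι → ℝ)} {I : Set ι} {a : ι → ℝ}
    (ha : a ∈ perp C) (ha0 : ∀ i, 0 ≤ a i) (hne : a ≠ 0) (hI : ∀ i ∉ I, a i = 0) :
    ¬ ∃ c ∈ C, ∀ i ∈ I, 0 < c i := by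
  rintro ⟨c, hc, hpos⟩
  have hnn : ∀ i ∈ Finset.univ, 0 ≤ c i * a i := fun i _ => by
    by_cases hi : i ∈ I
    · exact mul_nonneg (hpos i hi).le (ha0 i)
    · simp [hI i hi]
  have hz := (Finset.sum_eq_zero_iff_of_nonneg hnn).mp (mem_perp.mp ha c hc)
  refine hne (funext fun i => ?_)
  by_cases hi : i ∈ I
  · exact (mul_eq_zero.mp (hz i (Finset.mem_univ i))).resolve_left (hpos i hi).ne'
  · exact hI i hi

/-- Stiemke's alternative: if a vector of a subspace which is nonnegative on `I` has to vanish
on `I`, then the orthogonal complement contains a vector positive on `I` and zero off `I`. -/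
theorem exists_pos_mem_perp (A : Submodule ℝ (ι → ℝ)) (I : Set ι)
    (h : ∀ a ∈ A, (∀ i ∈ I, 0 ≤ a i) → ∀ i ∈ I, a i = 0) :
    ∃ c ∈ perp A, (∀ i ∈ I, 0 < c i) ∧ ∀ i ∉ I, c i = 0 := by
  classical
  by_contra hno
  -- Adding `vanishingOn I` forces the orthogonal vectors to be zero off `I`. Gordan's other option
  -- gives a nonnegative `b + r`, with `b ∈ A` and `r` zero on `I`, so the assumption applies to
  -- `b`.
  obtain ⟨a, ha, ha0, hne, hI⟩ := exists_nonneg_mem_perp (perp (A ⊔ vanishingOn I)) I (by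
    rintro ⟨c, hc, hpos⟩
    rw [mem_perp] at hc
    refine hno ⟨c, mem_perp.mpr fun a ha => hc a (Submodule.mem_sup_left ha), hpos,
      fun i hi => ?_⟩
    have := hc (Pi.single i 1) (Submodule.mem_sup_right fun j hj => by
      simp [show j ≠ i from fun e => hi (e ▸ hj)])
    simpa [Pi.single_apply] using this)
  rw [perp_perp, Submodule.mem_sup] at ha
  obtain ⟨b, hb, r, hr, rfl⟩ := ha
  rw [mem_vanishingOn] at hr
  have hz := h b hb fun i hi => by simpa [hr i hi] using ha0 i
  refine hne (funext fun i => ?_)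
  by_cases hi : i ∈ I
  · simp [hz i hi, hr i hi]
  · exact hI i hi

end Alternatives

/-! ### Affine functions and affine dependences of a finite point family. -/

section PointConfigurations

variable {d m : ℕ}

/-- The values at the points `y i` of the affine function `x ↦ ⟪v, x⟫ + t`. -/
noncomputable def affineEval (y : Fin m → EuclideanSpace ℝ (Fin d)) :
    (EuclideanSpace ℝ (Fin d) × ℝ) →ₗ[ℝ] (Fin m → ℝ) where
  toFun p i := inner ℝ p.1 (y i) + p.2
  map_add' p q := by
    ext i
    simp only [Prod.fst_add, Prod.snd_add, inner_add_left, Pi.add_apply]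
    ring
  map_smul' r p := by
    ext i
    simp [inner_smul_left, mul_add]

@[simp]
theorem affineEval_apply (y : Fin m → EuclideanSpace ℝ (Fin d))
    (p : EuclideanSpace ℝ (Fin d) × ℝ) (i : Fin m) :
    affineEval y p i = inner ℝ p.1 (y i) + p.2 := rfl

theorem mem_affineDependences {y : Fin m → EuclideanSpace ℝ (Fin d)} {a : Fin m → ℝ} :
    a ∈ affineDependences y ↔ ∑ i, a i = 0 ∧ ∑ i, a i • y i = 0 := Iff.rfl

theorem sum_affineEval_mul (y : Fin m → EuclideanSpace ℝ (Fin d))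
    (p : EuclideanSpace ℝ (Fin d) × ℝ) (a : Fin m → ℝ) :
    ∑ i, affineEval y p i * a i = inner ℝ p.1 (∑ i, a i • y i) + p.2 * ∑ i, a i := by
  simp [add_mul, Finset.sum_add_distrib, inner_sum, inner_smul_right, Finset.mul_sum,
    mul_comm (a _)]

/-- Pairing with constants yields `∑ a i = 0`; pairing with the linear function of the vector `∑ a i
• y i` itself yields its squared norm. -/
theorem perp_range_affineEval (y : Fin m → EuclideanSpace ℝ (Fin d)) :
    perp (LinearMap.range (affineEval y)) = affineDependences y := by
  ext a
  rw [mem_perp, mem_affineDependences]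
  constructor
  · intro h
    have h' := fun p => h _ (LinearMap.mem_range_self (affineEval y) p)
    simp only [sum_affineEval_mul] at h'
    have h1 : ∑ i, a i = 0 := by simpa using h' (0, 1)
    refine ⟨h1, ?_⟩
    have := h' (∑ i, a i • y i, 0)
    simpa [inner_self_eq_zero] using this
  · rintro ⟨h1, h2⟩ _ ⟨p, rfl⟩
    rw [sum_affineEval_mul, h1, h2]
    simp

theorem perp_affineDependences (y : Fin m → EuclideanSpace ℝ (Fin d)) :
    perp (affineDependences y) = LinearMap.range (affineEval y) := by
  rw [← perp_range_affineEval, perp_perp]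

theorem const_mem_range_affineEval (y : Fin m → EuclideanSpace ℝ (Fin d)) :
    (fun _ => 1) ∈ LinearMap.range (affineEval y) :=
  ⟨(0, 1), by ext; simp⟩

theorem finrank_affineDependences {y : Fin m → EuclideanSpace ℝ (Fin d)}
    (hy : Function.Injective (affineEval y)) :
    d + 1 + Module.finrank ℝ (affineDependences y) = m := by
  have h := finrank_add_finrank_perp (LinearMap.range (affineEval y))
  rw [perp_range_affineEval, LinearMap.finrank_range_of_inj hy] at h
  simpa using h

theorem mem_vectorSpan_orthogonal {E : Type*} [NormedAddCommGroup E] [InnerProductSpace ℝ E]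
    {s : Set E} {v : E} :
    v ∈ (vectorSpan ℝ s)ᗮ ↔ ∀ x ∈ s, ∀ z ∈ s, inner ℝ v x = inner ℝ v z := by
  rw [Submodule.mem_orthogonal']
  constructor
  · intro h x hx z hz
    have := h _ (vsub_mem_vectorSpan ℝ hx hz)
    rwa [vsub_eq_sub, inner_sub_right, sub_eq_zero] at this
  · intro h u hu
    rw [vectorSpan_def] at hu
    induction hu using Submodule.span_induction with
    | mem u hu =>
      obtain ⟨x, hx, z, hz, rfl⟩ := hu
      simp [inner_sub_right, h x hx z hz]
    | zero => simp
    | add a b _ _ ha hb => simp [inner_add_right, ha, hb]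
    | smul r a _ ha => simp [inner_smul_right, ha]

theorem vectorSpan_convexHull_eq {E : Type*} [AddCommGroup E] [Module ℝ E] (s : Set E) :
    vectorSpan ℝ (convexHull ℝ s) = vectorSpan ℝ s := by
  rw [← direction_affineSpan, affineSpan_convexHull, direction_affineSpan]

theorem hullDim_of_nonempty {E : Type*} [AddCommGroup E] [Module ℝ E] {s : Set E}
    (hs : s.Nonempty) : hullDim s = Module.finrank ℝ (vectorSpan ℝ s) := by
  unfold hullDim
  rw [if_neg hs.ne_empty]

/-- The values at the points determine an affine function iff the points affinely span. -/
theorem injective_affineEval_iff (y : Fin m → EuclideanSpace ℝ (Fin d)) :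
    Function.Injective (affineEval y) ↔ hullDim (convexHull ℝ (Set.range y)) = d := by
  rw [injective_iff_map_eq_zero]
  rcases (Set.range y).eq_empty_or_nonempty with he | hne
  · have hm : IsEmpty (Fin m) := Set.range_eq_empty_iff.mp he
    have h1 : hullDim (convexHull ℝ (Set.range y)) = -1 := by
      simp [hullDim, he]
    rw [h1]
    constructor
    · intro h
      have := h (0, 1) (Subsingleton.elim _ _)
      simp at this
    · omega
  obtain ⟨i₀⟩ := Set.range_nonempty_iff_nonempty.mp hne
  rw [hullDim_of_nonempty hne.convexHull, vectorSpan_convexHull_eq, Nat.cast_inj]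
  have hfin : Module.finrank ℝ (EuclideanSpace ℝ (Fin d)) = d := by simp
  constructor
  · intro h
    have : vectorSpan ℝ (Set.range y) = ⊤ := by
      rw [← Submodule.orthogonal_eq_bot_iff, Submodule.eq_bot_iff]
      intro v hv
      rw [mem_vectorSpan_orthogonal] at hv
      -- A normal `v` to all differences gives an affine function vanishing at every point.
      have := h (v, - inner ℝ v (y i₀)) (by
        ext i
        simp [hv _ (Set.mem_range_self i) _ (Set.mem_range_self i₀)])
      exact congrArg Prod.fst this
    rw [this, finrank_top, hfin]
  · rintro h ⟨v, t⟩ hp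
    have htop : vectorSpan ℝ (Set.range y) = ⊤ :=
      Submodule.eq_top_of_finrank_eq (by rw [h, hfin])
    have hv : v ∈ (vectorSpan ℝ (Set.range y))ᗮ := by
      rw [mem_vectorSpan_orthogonal]
      rintro _ ⟨i, rfl⟩ _ ⟨j, rfl⟩
      have hi := congrFun hp i
      have hj := congrFun hp j
      simp only [affineEval_apply, Pi.zero_apply] at hi hj
      linarith
    rw [htop, Submodule.top_orthogonal_eq_bot, Submodule.mem_bot] at hv
    subst hv
    have := congrFun hp i₀
    simpa using this

theorem mem_convexHull_range_iff {E : Type*} [AddCommGroup E] [Module ℝ E] {y : Fin m → E}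
    {x : E} :
    x ∈ convexHull ℝ (Set.range y) ↔
      ∃ w : Fin m → ℝ, (∀ i, 0 ≤ w i) ∧ ∑ i, w i = 1 ∧ ∑ i, w i • y i = x := by
  have h : convexHull ℝ (Set.range y) =
      Fintype.linearCombination ℝ y '' stdSimplex ℝ (Fin m) := by
    rw [← convexHull_rangle_single_eq_stdSimplex, LinearMap.image_convexHull, ← Set.range_comp]
    congr 2
    ext i
    simp
  rw [h]
  simp [stdSimplex, Fintype.linearCombination_apply, and_assoc]

theorem sum_smul_mem_convexHull_image {E : Type*} [AddCommGroup E] [Module ℝ E]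
    {y : Fin m → E} {I : Set (Fin m)} {w : Fin m → ℝ} (h0 : ∀ i, 0 ≤ w i)
    (h1 : ∑ i, w i = 1) (hI : ∀ i ∉ I, w i = 0) :
    ∑ i, w i • y i ∈ convexHull ℝ (y '' I) := by
  classical
  have e1 : ∑ i ∈ Finset.univ.filter (· ∈ I), w i = ∑ i, w i :=
    Finset.sum_subset (Finset.filter_subset _ _) fun i _ hi => hI i (by simpa using hi)
  have e2 : ∑ i ∈ Finset.univ.filter (· ∈ I), w i • y i = ∑ i, w i • y i :=
    Finset.sum_subset (Finset.filter_subset _ _) fun i _ hi => by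
      rw [hI i (by simpa using hi), zero_smul]
  rw [← e2]
  refine (convex_convexHull ℝ _).sum_mem (fun i _ => h0 i) (e1.trans h1) fun i hi => ?_
  exact subset_convexHull ℝ _ (Set.mem_image_of_mem y (by simpa using hi))

theorem inner_sum_smul_add {y : Fin m → EuclideanSpace ℝ (Fin d)}
    (p : EuclideanSpace ℝ (Fin d) × ℝ) {w : Fin m → ℝ} (h1 : ∑ i, w i = 1) :
    inner ℝ p.1 (∑ i, w i • y i) + p.2 = ∑ i, affineEval y p i * w i := by
  rw [sum_affineEval_mul, h1, mul_one]

/-- The points are distinct vertices of their convex hull iff every nonzero affine dependence has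
at least two positive coefficients. -/
theorem injective_and_range_eq_extremePoints_iff (y : Fin m → EuclideanSpace ℝ (Fin d)) :
    (Function.Injective y ∧ Set.range y = (convexHull ℝ (Set.range y)).extremePoints ℝ) ↔
      ∀ a ∈ affineDependences y, ∀ i, (∀ j ≠ i, a j ≤ 0) → a = 0 := by
  classical
  constructor
  · rintro ⟨hinj, hext⟩ a ⟨ha1, ha2⟩ i hi
    -- If `a i = 0`, all coefficients vanish; if `a i > 0`, dividing by it writes `y i` as a convex
    -- combination of the other points, against extremality.
    have hai : a i = ∑ j ∈ Finset.univ.erase i, -a j := by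
      rw [← Finset.add_sum_erase _ _ (Finset.mem_univ i)] at ha1
      rw [Finset.sum_neg_distrib]
      linarith
    have hnn : ∀ j ∈ Finset.univ.erase i, 0 ≤ -a j := fun j hj => by
      have := hi j (Finset.ne_of_mem_erase hj)
      linarith
    have hai0 : 0 ≤ a i := hai ▸ Finset.sum_nonneg hnn
    rcases hai0.eq_or_lt with h0 | hpos
    · rw [← h0] at hai
      have := (Finset.sum_eq_zero_iff_of_nonneg hnn).mp hai.symm
      ext j
      by_cases hj : j = i
      · rw [hj, ← h0]; rfl
      · simpa using this j (by simp [hj])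
    · exfalso
      have hex : y i ∈ (convexHull ℝ (Set.range y)).extremePoints ℝ :=
        hext ▸ Set.mem_range_self i
      rw [(convex_convexHull ℝ _).mem_extremePoints_iff_convex_sdiff] at hex
      have hmem := hex.2.sum_mem (t := Finset.univ.erase i) (w := fun j => -a j / a i) (z := y)
        (fun j hj => div_nonneg (hnn j hj) hai0)
        (by rw [← Finset.sum_div, ← hai, div_self hpos.ne'])
        (fun j hj => ⟨subset_convexHull ℝ _ (Set.mem_range_self j), fun e =>
          Finset.ne_of_mem_erase hj (hinj e)⟩)
      apply hmem.2
      rw [← Finset.add_sum_erase _ _ (Finset.mem_univ i)] at ha2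
      have h3 : ∑ j ∈ Finset.univ.erase i, (-a j / a i) • y j =
          (a i)⁻¹ • ∑ j ∈ Finset.univ.erase i, -(a j • y j) := by
        rw [Finset.smul_sum]
        refine Finset.sum_congr rfl fun j _ => ?_
        rw [← neg_smul, smul_smul, div_eq_inv_mul]
      rw [Set.mem_singleton_iff, h3, Finset.sum_neg_distrib, ← eq_neg_of_add_eq_zero_left ha2,
        smul_smul, inv_mul_cancel₀ hpos.ne', one_smul]
  · intro h
    -- Each `y i` has only the trivial convex representation: the difference of the two weight
    -- vectors is a dependence that is nonpositive away from `i`.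
    have key : ∀ w : Fin m → ℝ, (∀ j, 0 ≤ w j) → ∑ j, w j = 1 →
        ∀ i, ∑ j, w j • y j = y i → w = Pi.single i 1 := by
      intro w hw0 hw1 i hwi
      have := h (Pi.single i 1 - w) (by
        rw [mem_affineDependences]
        simp [sub_smul, hw1, hwi, Pi.single_apply, ite_smul]) i fun j hj => by
          simpa [Pi.single_apply, hj] using hw0 j
      exact (sub_eq_zero.mp this).symm
    refine ⟨fun i j hij => ?_, Set.Subset.antisymm ?_ extremePoints_convexHull_subset⟩
    · have := key (Pi.single j 1) (fun k => by
        by_cases hk : k = j <;> simp [hk]) (by simp) i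
        (by simp [Pi.single_apply, ite_smul, hij])
      by_contra hne
      have := congrFun this i
      simp [hne] at this
    · rintro _ ⟨i, rfl⟩
      rw [mem_extremePoints_iff_left]
      refine ⟨subset_convexHull ℝ _ (Set.mem_range_self i), fun x₁ hx₁ x₂ hx₂ hseg => ?_⟩
      obtain ⟨w₁, h10, h11, rfl⟩ := mem_convexHull_range_iff.mp hx₁
      obtain ⟨w₂, h20, h21, rfl⟩ := mem_convexHull_range_iff.mp hx₂
      obtain ⟨α, β, hα, hβ, hαβ, hsum⟩ := hseg
      have hw := key (fun j => α * w₁ j + β * w₂ j)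
        (fun j => add_nonneg (mul_nonneg hα.le (h10 j)) (mul_nonneg hβ.le (h20 j)))
        (by rw [Finset.sum_add_distrib, ← Finset.mul_sum, ← Finset.mul_sum, h11, h21]; linarith)
        i (by
          rw [← hsum]
          simp [add_smul, mul_smul, Finset.sum_add_distrib, Finset.smul_sum])
      have hz : ∀ j ≠ i, w₁ j = 0 := fun j hj => by
        have := congrFun hw j
        simp only [Pi.single_apply, hj, if_false] at this
        have h2 : α * w₁ j = 0 := by
          linarith [mul_nonneg hα.le (h10 j), mul_nonneg hβ.le (h20 j)]
        exact (mul_eq_zero.mp h2).resolve_left hα.ne'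
      have hi1 : w₁ i = 1 := by
        rw [← h11]
        exact (Finset.sum_eq_single i (fun j _ hj => hz j hj) (by simp)).symm
      rw [Finset.sum_eq_single i (fun j _ hj => by rw [hz j hj, zero_smul]) (by simp), hi1,
        one_smul]

/-- Affine independence of a subfamily in terms of affine dependences. -/
theorem affineIndependent_subtype_iff (y : Fin m → EuclideanSpace ℝ (Fin d))
    (p : Fin m → Prop) :
    AffineIndependent ℝ (fun i : {i // p i} => y i) ↔
      ∀ a ∈ affineDependences y, (∀ i, ¬ p i → a i = 0) → a = 0 := by
  classical
  have hsum : ∀ {M : Type} [AddCommMonoid M] (f : Fin m → M), (∀ i, ¬ p i → f i = 0) →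
      ∑ i : {i // p i}, f i = ∑ i, f i := by
    intro M _ f hf
    rw [← Finset.sum_subtype (Finset.univ.filter p) (by simp)]
    exact Finset.sum_subset (Finset.filter_subset _ _) fun i _ hi => hf i (by simpa using hi)
  rw [affineIndependent_iff_of_fintype]
  constructor
  · rintro h a ⟨ha1, ha2⟩ ha
    have h1 : ∑ i : {i // p i}, a i = 0 := (hsum a ha).trans ha1
    have h2 := h (fun i => a i) h1 (by
      rw [Finset.weightedVSub_eq_linear_combination _ h1]
      exact (hsum (fun i => a i • y i) fun i hi => by rw [ha i hi, zero_smul]).trans ha2)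
    ext i
    by_cases hi : p i
    · exact h2 ⟨i, hi⟩
    · exact ha i hi
  · intro h w hw1 hw2 i
    rw [Finset.weightedVSub_eq_linear_combination _ hw1] at hw2
    set a : Fin m → ℝ := fun i => if hi : p i then w ⟨i, hi⟩ else 0 with ha
    have hp : ∀ i, ¬ p i → a i = 0 := fun i hi => by simp [ha, hi]
    have hw : ∀ i : {i // p i}, a i = w i := fun i => by simp [ha, i.2]
    have h0 := h a ⟨by rw [← hsum a hp]; simpa [hw] using hw1, by
      rw [← hsum (fun i => a i • y i) fun i hi => by rw [hp i hi, zero_smul]]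
      simpa [hw] using hw2⟩ hp
    rw [← hw, h0]
    rfl

end PointConfigurations

/-! ### Faces, facets and the nerve-complex through affine functions. -/

namespace LabeledPolytope

variable {d m : ℕ} (P : LabeledPolytope d m)

theorem injective_affineEval : Function.Injective (affineEval P.vertex) :=
  (injective_affineEval_iff P.vertex).mpr P.dim_eq

theorem eq_zero_of_nonpos {a : Fin m → ℝ} (ha : a ∈ affineDependences P.vertex) {i : Fin m}
    (hi : ∀ j ≠ i, a j ≤ 0) : a = 0 :=
  (injective_and_range_eq_extremePoints_iff P.vertex).mp ⟨P.injective, P.range_eq⟩ a ha i hi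

theorem vertex_mem_carrier (i : Fin m) : P.vertex i ∈ P.carrier :=
  subset_convexHull ℝ _ (Set.mem_range_self i)

theorem nonempty_labels (P : LabeledPolytope d m) : Nonempty (Fin m) := by
  by_contra hm
  rw [not_nonempty_iff] at hm
  have := P.injective_affineEval (a₁ := (0, 1)) (a₂ := 0) (Subsingleton.elim _ _)
  simp at this

theorem eval_nonneg {p : EuclideanSpace ℝ (Fin d) × ℝ} (h : ∀ i, 0 ≤ affineEval P.vertex p i)
    {x : EuclideanSpace ℝ (Fin d)} (hx : x ∈ P.carrier) : 0 ≤ inner ℝ p.1 x + p.2 := by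
  obtain ⟨w, h0, h1, rfl⟩ := mem_convexHull_range_iff.mp hx
  rw [inner_sum_smul_add p h1]
  exact Finset.sum_nonneg fun i _ => mul_nonneg (h i) (h0 i)

/-- The zeros of an affine function which is nonnegative on `P` form an exposed set. -/
theorem isExposed_zeros {p : EuclideanSpace ℝ (Fin d) × ℝ}
    (h : ∀ i, 0 ≤ affineEval P.vertex p i) :
    IsExposed ℝ P.carrier {x ∈ P.carrier | inner ℝ p.1 x + p.2 = 0} := by
  rintro ⟨x₀, hx₀, hz⟩
  refine ⟨-innerSL ℝ p.1, Set.ext fun x => and_congr_right fun hx => ?_⟩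
  simp only [neg_apply, innerSL_apply_apply]
  constructor
  · intro hx0 z hzc
    linarith [P.eval_nonneg h hzc]
  · intro hmax
    linarith [P.eval_nonneg h hx, hmax x₀ hx₀]

/-- The zeros in `P` of an affine function which is nonnegative, but not zero, on `P` form a
proper face. -/
theorem isProperFace_zeros {p : EuclideanSpace ℝ (Fin d) × ℝ}
    (h : ∀ i, 0 ≤ affineEval P.vertex p i) (hne : affineEval P.vertex p ≠ 0) :
    P.IsProperFace {x ∈ P.carrier | inner ℝ p.1 x + p.2 = 0} := by
  refine ⟨P.isExposed_zeros h, fun he => hne (funext fun i => ?_)⟩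
  have := P.vertex_mem_carrier i
  rw [← he] at this
  exact this.2

/-- A proper face lies in the zero set of an affine function which is nonnegative, but not zero,
on `P`. -/
theorem IsProperFace.exists_eval {F : Set (EuclideanSpace ℝ (Fin d))} (hF : P.IsProperFace F) :
    ∃ c ∈ LinearMap.range (affineEval P.vertex), (∀ i, 0 ≤ c i) ∧ c ≠ 0 ∧
      ∀ i, P.vertex i ∈ F → c i = 0 := by
  obtain ⟨hexp, hne⟩ := hF
  rcases F.eq_empty_or_nonempty with rfl | hFne
  · refine ⟨_, const_mem_range_affineEval _, by simp, fun h => ?_, by simp⟩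
    obtain ⟨i⟩ := P.nonempty_labels
    simpa using congrFun h i
  obtain ⟨l, hl⟩ := hexp hFne
  obtain ⟨x₀, hx₀⟩ := hFne
  have hx₀' := hx₀
  rw [hl] at hx₀'
  have hv : ∀ x, inner ℝ ((InnerProductSpace.toDual ℝ _).symm l) x = l x := fun x =>
    InnerProductSpace.toDual_symm_apply
  -- The affine function `l x₀ - l` measures the defect from the maximum of `l`, so it vanishes on
  -- `F`; if it vanished at all vertices, `F` would be `P`.
  have hp : ∀ i, affineEval P.vertex (-(InnerProductSpace.toDual ℝ _).symm l, l x₀) i =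
      l x₀ - l (P.vertex i) := fun i => by
    rw [affineEval_apply, inner_neg_left, hv]; ring
  refine ⟨_, ⟨(-(InnerProductSpace.toDual ℝ _).symm l, l x₀), rfl⟩, fun i => ?_, fun h0 => ?_,
    fun i hi => ?_⟩
  · rw [hp]
    linarith [hx₀'.2 _ (P.vertex_mem_carrier i)]
  · have hval : ∀ x ∈ P.carrier, l x = l x₀ := by
      intro x hx
      obtain ⟨w, -, h1, rfl⟩ := mem_convexHull_range_iff.mp hx
      have := inner_sum_smul_add (y := P.vertex)
        (-(InnerProductSpace.toDual ℝ _).symm l, l x₀) h1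
      rw [h0, inner_neg_left, hv] at this
      simp only [Pi.zero_apply, zero_mul, Finset.sum_const_zero] at this
      linarith
    apply hne
    rw [hl]
    ext x
    refine ⟨fun h => h.1, fun hx => ⟨hx, fun z hz => ?_⟩⟩
    rw [hval x hx, hval z hz]
  · rw [hl] at hi
    rw [hp]
    linarith [hi.2 _ hx₀'.1, hx₀'.2 _ hi.1]

/-- If the zero set of `c` is maximal among the zero sets of nonzero nonnegative values of affine
functions, then each affine function vanishing on it is a multiple of that of `c`. -/
theorem _root_.exists_eq_smul_of_maximal_zeros {ι : Type*} [Finite ι]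
    {B : Submodule ℝ (ι → ℝ)} {c : ι → ℝ} (hc : c ∈ B) (hc0 : ∀ i, 0 ≤ c i) (hne : c ≠ 0)
    (hmax : ∀ e ∈ B, (∀ i, 0 ≤ e i) → e ≠ 0 → (∀ i, c i = 0 → e i = 0) →
      ∀ i, e i = 0 → c i = 0)
    {h : ι → ℝ} (hh : h ∈ B) (hz : ∀ i, c i = 0 → h i = 0) : ∃ r : ℝ, h = r • c := by
  classical
  have hS : {i | c i ≠ 0}.Nonempty := Function.ne_iff.mp hne
  -- Subtracting the least ratio times `c` keeps `h` nonnegative and creates an extra zero at `i₀`,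
  -- which maximality permits only if the difference is zero.
  obtain ⟨i₀, hi₀, hmin⟩ := Set.exists_min_image _ (fun i => h i / c i) (Set.toFinite _) hS
  refine ⟨h i₀ / c i₀, ?_⟩
  by_contra hcon
  refine hi₀ (hmax (h - (h i₀ / c i₀) • c) (B.sub_mem hh (B.smul_mem _ hc)) (fun i => ?_)
    (sub_ne_zero.mpr hcon) (fun i hi => by simp [hi, hz i hi]) i₀ ?_)
  · by_cases hi : c i = 0
    · simp [hi, hz i hi]
    · have hpos : 0 < c i := lt_of_le_of_ne (hc0 i) (Ne.symm hi)
      have := (le_div_iff₀ hpos).mp (hmin i hi)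
      simpa using this
  · have : c i₀ ≠ 0 := hi₀
    simp [div_mul_cancel₀ _ this]

/-- The zero set in `P` of an affine function `p`, nonnegative and not zero on `P`, is a facet if
`p` is determined up to a factor by its zeros among the vertices. -/
theorem isFacet_zeros {p : EuclideanSpace ℝ (Fin d) × ℝ}
    (h : ∀ i, 0 ≤ affineEval P.vertex p i) (hne : affineEval P.vertex p ≠ 0)
    (huniq : ∀ q : EuclideanSpace ℝ (Fin d) × ℝ,
      (∀ i, affineEval P.vertex p i = 0 → affineEval P.vertex q i = 0) → ∃ r : ℝ, q = r • p) :
    P.IsFacet {x ∈ P.carrier | inner ℝ p.1 x + p.2 = 0} := by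
  refine ⟨P.isProperFace_zeros h hne, ?_⟩
  by_cases hZ : ∃ i, affineEval P.vertex p i = 0
  · obtain ⟨i₀, hi₀⟩ := hZ
    have hmem : ∀ i, affineEval P.vertex p i = 0 →
        P.vertex i ∈ {x ∈ P.carrier | inner ℝ p.1 x + p.2 = 0} :=
      fun i hi => ⟨P.vertex_mem_carrier i, hi⟩
    rw [hullDim_of_nonempty ⟨_, hmem i₀ hi₀⟩]
    have hv : p.1 ≠ 0 := by
      intro h0
      have ht : p.2 = 0 := by simpa [h0] using hi₀
      exact hne (by ext; simp [h0, ht])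
    -- Normals to the face correspond to affine functions vanishing on its vertices, hence to
    -- multiples of `p`; so the face has codimension one.
    have hspan : (vectorSpan ℝ {x ∈ P.carrier | inner ℝ p.1 x + p.2 = 0})ᗮ =
        Submodule.span ℝ {p.1} := by
      ext u
      rw [mem_vectorSpan_orthogonal, Submodule.mem_span_singleton]
      constructor
      · intro hu
        obtain ⟨r, hr⟩ := huniq (u, -inner ℝ u (P.vertex i₀)) fun i hi => by
          simp [hu _ (hmem i hi) _ (hmem i₀ hi₀)]
        exact ⟨r, (congrArg Prod.fst hr).symm⟩
      · rintro ⟨r, rfl⟩ x hx z hz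
        rw [inner_smul_left, inner_smul_left,
          show inner ℝ p.1 x = inner ℝ p.1 z by linarith [hx.2, hz.2]]
    have := Submodule.finrank_add_finrank_orthogonal
      (vectorSpan ℝ {x ∈ P.carrier | inner ℝ p.1 x + p.2 = 0})
    rw [hspan, finrank_span_singleton hv, finrank_euclideanSpace_fin] at this
    omega
  -- Without zeros, `huniq` makes every affine function a multiple of `p`. This forces `d = 0`,
  -- where the empty face is the facet of dimension `-1`.
  · push Not at hZ
    have hE : {x ∈ P.carrier | inner ℝ p.1 x + p.2 = 0} = ∅ := by
      rw [Set.eq_empty_iff_forall_notMem]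
      rintro x ⟨hx, hx0⟩
      obtain ⟨w, h0, h1, rfl⟩ := mem_convexHull_range_iff.mp hx
      rw [inner_sum_smul_add p h1, Finset.sum_eq_zero_iff_of_nonneg
        fun i _ => mul_nonneg (h i) (h0 i)] at hx0
      have : ∀ i, w i = 0 := fun i =>
        (mul_eq_zero.mp (hx0 i (Finset.mem_univ i))).resolve_left (hZ i)
      simp [this] at h1
    obtain ⟨r, hr⟩ := huniq (0, 1) fun i hi => absurd hi (hZ i)
    have hr0 : r ≠ 0 := by rintro rfl; simpa using congrArg Prod.snd hr
    have hp1 : p.1 = 0 := by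
      have := congrArg Prod.fst hr
      simpa [hr0] using this.symm
    have hall : ∀ u : EuclideanSpace ℝ (Fin d), u = 0 := fun u => by
      obtain ⟨s, hs⟩ := huniq (u, 0) fun i hi => absurd hi (hZ i)
      simpa [hp1] using congrArg Prod.fst hs
    have hd : d = 0 := by
      have : Subsingleton (EuclideanSpace ℝ (Fin d)) := ⟨fun a b => by rw [hall a, hall b]⟩
      simpa using Module.finrank_zero_of_subsingleton (R := ℝ) (M := EuclideanSpace ℝ (Fin d))
    simp [hE, hullDim, hd]

/-- Each proper face of a polytope lies in a facet. -/
theorem exists_isFacet {c : Fin m → ℝ} (hc : c ∈ LinearMap.range (affineEval P.vertex))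
    (hc0 : ∀ i, 0 ≤ c i) (hne : c ≠ 0) :
    ∃ F, P.IsFacet F ∧ ∀ i, c i = 0 → P.vertex i ∈ F := by
  let S : Set (Set (Fin m)) := {Z | ∃ e ∈ LinearMap.range (affineEval P.vertex),
    (∀ i, 0 ≤ e i) ∧ e ≠ 0 ∧ {i | e i = 0} = Z}
  -- There are finitely many zero sets; a maximal one above that of `c` cuts out a facet.
  obtain ⟨Z, hZ, ⟨_, ⟨p, rfl⟩, he0, hene, rfl⟩, hmax⟩ :=
    (Set.toFinite S).exists_le_maximal (a := {i | c i = 0}) ⟨c, hc, hc0, hne, rfl⟩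
  refine ⟨_, P.isFacet_zeros he0 hene fun q hq => ?_,
    fun i hi => ⟨P.vertex_mem_carrier i, hZ hi⟩⟩
  obtain ⟨r, hr⟩ := exists_eq_smul_of_maximal_zeros (LinearMap.mem_range_self (affineEval P.vertex) p)
    he0 hene (fun e heB he0' hne' hsub => hmax ⟨e, heB, he0', hne', rfl⟩ hsub)
    (LinearMap.mem_range_self _ q) hq
  exact ⟨r, P.injective_affineEval (by rw [hr, map_smul])⟩

/-- The simplices of the nerve-complex are the sets on which some affine function vanishes that
is nonnegative, but not zero, on the vertices. -/
theorem mem_nerveComplex_iff_exists_eval {I : Finset (Fin m)} :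
    I ∈ P.nerveComplex.faces ↔ ∃ c ∈ LinearMap.range (affineEval P.vertex),
      (∀ i, 0 ≤ c i) ∧ c ≠ 0 ∧ ∀ i ∈ I, c i = 0 := by
  constructor
  · rintro (rfl | ⟨F, hF, hI⟩)
    · refine ⟨_, const_mem_range_affineEval _, by simp, fun h => ?_, by simp⟩
      obtain ⟨i⟩ := P.nonempty_labels
      simpa using congrFun h i
    · obtain ⟨c, hc, hc0, hne, hz⟩ := hF.1.exists_eval
      exact ⟨c, hc, hc0, hne, fun i hi => hz i (hI i hi)⟩
  · rintro ⟨c, hc, hc0, hne, hz⟩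
    obtain ⟨F, hF, hFc⟩ := P.exists_isFacet hc hc0 hne
    exact Or.inr ⟨F, hF, fun i hi => hFc i (hz i hi)⟩

/-- Gordan's alternative for the dependences and the complement of `I`: the nonnegative vector it
provides is a supporting affine function. -/
theorem mem_nerveComplex_iff {I : Finset (Fin m)} :
    I ∈ P.nerveComplex.faces ↔
      ¬ ∃ a ∈ affineDependences P.vertex, ∀ i ∉ I, 0 < a i := by
  rw [mem_nerveComplex_iff_exists_eval, ← perp_affineDependences]
  constructor
  · rintro ⟨c, hc, hc0, hne, hz⟩
    exact not_exists_pos_of_nonneg_mem_perp (I := {i | i ∉ I}) hc hc0 hne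
      fun i hi => hz i (not_not.mp hi)
  · intro h
    obtain ⟨c, hc, hc0, hne, hz⟩ := exists_nonneg_mem_perp _ {i | i ∉ I} h
    exact ⟨c, hc, hc0, hne, fun i hi => hz i (not_not.mpr hi)⟩

/-- Affine independence passes to subfamilies, so the facets may be replaced by all simplices of the
nerve-complex. -/
theorem isSimplicial_iff :
    P.IsSimplicial ↔ ∀ I ∈ P.nerveComplex.faces, ∀ a ∈ affineDependences P.vertex,
      (∀ i ∉ I, a i = 0) → a = 0 := by
  classical
  constructor
  · rintro h I (rfl | ⟨F, hF, hI⟩) a ha hz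
    · exact funext fun i => hz i (by simp)
    · exact (affineIndependent_subtype_iff P.vertex _).mp (h F hF) a ha
        fun i hi => hz i fun hiI => hi (hI i hiI)
  · intro h F hF
    rw [affineIndependent_subtype_iff]
    intro a ha hz
    exact h (Finset.univ.filter fun i => P.vertex i ∈ F) (Or.inr ⟨F, hF, by simp⟩) a ha
      fun i hi => hz i (by simpa using hi)

/-- The boundary complex of a simplicial polytope is its nerve-complex. -/
theorem IsSimplicial.boundaryFaces_eq (hP : P.IsSimplicial) :
    P.boundaryFaces = P.nerveComplex.faces := by
  ext I
  constructor
  · intro hI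
    obtain ⟨c, hc, hc0, hne, hz⟩ := IsProperFace.exists_eval P hI
    exact P.mem_nerveComplex_iff_exists_eval.mpr ⟨c, hc, hc0, hne, fun i hi =>
      hz i (subset_convexHull ℝ _ (Set.mem_image_of_mem _ hi))⟩
  · intro hI
    obtain ⟨f, hf, hf0, hfne, hfz⟩ := P.mem_nerveComplex_iff_exists_eval.mp hI
    -- Stiemke's alternative yields an affine function whose zeros among the vertices are exactly
    -- `I`. Its hypothesis holds because a dependence `a ≥ 0` off `I`, paired with `f`, is supported
    -- on the zeros of `f`, and these are affinely independent.
    obtain ⟨c, hc, hcpos, hcz⟩ := exists_pos_mem_perp (affineDependences P.vertex)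
      {i | i ∉ I} fun a ha ha0 => by
        rw [← perp_affineDependences, mem_perp] at hf
        have hfa := (Finset.sum_eq_zero_iff_of_nonneg fun i _ => by
          by_cases hi : i ∈ I
          · simp [hfz i hi]
          · exact mul_nonneg (ha0 i hi) (hf0 i)).mp (hf a ha)
        have := P.isSimplicial_iff.mp hP (Finset.univ.filter fun i => f i = 0)
          (P.mem_nerveComplex_iff_exists_eval.mpr
            ⟨f, by rwa [← perp_affineDependences, mem_perp], hf0, hfne, by simp⟩) a ha
          fun i hi => (mul_eq_zero.mp (hfa i (Finset.mem_univ i))).resolve_right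
            (by simpa using hi)
        simp [this]
    rw [perp_affineDependences] at hc
    obtain ⟨p, rfl⟩ := hc
    have hp0 : ∀ i, 0 ≤ affineEval P.vertex p i := fun i => by
      by_cases hi : i ∈ I
      · exact (hcz i (not_not.mpr hi)).ge
      · exact (hcpos i hi).le
    have hpne : affineEval P.vertex p ≠ 0 := by
      obtain ⟨i, hi⟩ := Function.ne_iff.mp hfne
      exact fun h => (hcpos i fun hiI => hi (hfz i hiI)).ne' (congrFun h i)
    have hface : convexHull ℝ (P.vertex '' (I : Set (Fin m))) =
        {x ∈ P.carrier | inner ℝ p.1 x + p.2 = 0} := by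
      apply Set.Subset.antisymm
      · refine convexHull_min ?_ ?_
        · rintro _ ⟨i, hi, rfl⟩
          exact ⟨P.vertex_mem_carrier i, hcz i (not_not.mpr hi)⟩
        · exact (P.isExposed_zeros hp0).convex (convex_convexHull ℝ _)
      · rintro x ⟨hx, hx0⟩
        obtain ⟨w, h0, h1, rfl⟩ := mem_convexHull_range_iff.mp hx
        rw [inner_sum_smul_add p h1, Finset.sum_eq_zero_iff_of_nonneg
          fun i _ => mul_nonneg (hp0 i) (h0 i)] at hx0
        exact sum_smul_mem_convexHull_image h0 h1 fun i hi =>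
          (mul_eq_zero.mp (hx0 i (Finset.mem_univ i))).resolve_left (hcpos i hi).ne'
    change P.IsProperFace _
    rw [hface]
    exact P.isProperFace_zeros hp0 hpne

end LabeledPolytope

/-! ### Gale diagrams as parametrizations of a subspace up to positive factors. -/

section GaleDiagrams

variable {d m n : ℕ}

theorem isConfiguration_iff {X : Fin m → EuclideanSpace ℝ (Fin n)} :
    IsConfiguration X ↔ ∀ i, NormedSpace.normalize (X i) = X i := by
  refine forall_congr' fun i => ?_
  rw [mem_sphere_zero_iff_norm]
  constructor
  · rintro (h | h)
    · exact NormedSpace.normalize_eq_self_of_norm_eq_one h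
    · rw [h, NormedSpace.normalize_zero_eq_zero]
  · intro h
    by_cases h0 : X i = 0
    · exact Or.inr h0
    · exact Or.inl (h ▸ NormedSpace.norm_normalize h0)

/-- `X` represents the subspace `A` of `ℝ^m` up to positive factors: the vectors of `A` are those
with coordinates `s i * ⟪X i, w⟫`, and `w` is determined by the vector. -/
def Represents (X : Fin m → EuclideanSpace ℝ (Fin n)) (A : Submodule ℝ (Fin m → ℝ)) : Prop :=
  ∃ s : Fin m → ℝ, (∀ i, 0 < s i) ∧ ∃ e : EuclideanSpace ℝ (Fin n) ≃ₗ[ℝ] A,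
    ∀ w i, (e w : Fin m → ℝ) i = s i * inner ℝ (X i) w

/-- A basis of the dependences is an isomorphism from `ℝ^n` whose `i`-th coordinate is the inner
product with the `i`-th row; the row lengths become the factors `s i`. -/
theorem isGaleDiagram_iff {y : Fin m → EuclideanSpace ℝ (Fin d)}
    {X : Fin m → EuclideanSpace ℝ (Fin n)} :
    IsGaleDiagram y X ↔ IsConfiguration X ∧ Represents X (affineDependences y) := by
  classical
  constructor
  · rintro ⟨g, ⟨b, hb⟩, hX⟩
    refine ⟨isConfiguration_iff.mpr fun i => by rw [hX, NormedSpace.normalize_normalize],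
      -- A zero row allows any positive factor; 1 is chosen.
      fun i => if g i = 0 then 1 else ‖g i‖, fun i => ?_,
      (WithLp.linearEquiv 2 ℝ (Fin n → ℝ)).trans b.equivFun.symm, fun w i => ?_⟩
    · dsimp only
      split_ifs with h
      · exact one_pos
      · exact norm_pos_iff.mpr h
    · have h1 : (if g i = 0 then 1 else ‖g i‖) * inner ℝ (X i) w = inner ℝ (g i) w := by
        split_ifs with h
        · simp [hX, h]
        · rw [← real_inner_smul_left, hX, NormedSpace.norm_smul_normalize]
      rw [h1]
      simp [Module.Basis.equivFun_symm_apply, PiLp.inner_apply, hb]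
  · rintro ⟨hX, s, hs, e, he⟩
    refine ⟨fun i => s i • X i, ⟨(EuclideanSpace.basisFun (Fin n) ℝ).toBasis.map e,
      fun i j => ?_⟩, fun i => ?_⟩
    · simp [he, EuclideanSpace.inner_single_right]
    · rw [NormedSpace.normalize_smul_of_pos (hs i), isConfiguration_iff.mp hX]

theorem exists_isGaleDiagram {y : Fin m → EuclideanSpace ℝ (Fin d)}
    (hn : Module.finrank ℝ (affineDependences y) = n) :
    ∃ X : Fin m → EuclideanSpace ℝ (Fin n), IsGaleDiagram y X := by
  let b := Module.finBasisOfFinrankEq ℝ (affineDependences y) hn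
  exact ⟨_, fun i => WithLp.toLp 2 fun j => (b j : Fin m → ℝ) i, ⟨b, fun i j => rfl⟩,
    fun i => rfl⟩

namespace Represents

variable {X : Fin m → EuclideanSpace ℝ (Fin n)} {A : Submodule ℝ (Fin m → ℝ)}

theorem mem_constellationComplex_iff (h : Represents X A) {I : Finset (Fin m)} :
    I ∈ (constellationComplex X).faces ↔ ∃ a ∈ A, ∀ i ∈ I, 0 < a i := by
  obtain ⟨s, hs, e, he⟩ := h
  constructor
  · rintro ⟨w, hw⟩
    refine ⟨e w, (e w).2, fun i hi => ?_⟩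
    rw [he]
    exact mul_pos (hs i) (Set.mem_iInter₂.mp hw i hi).2
  · rintro ⟨a, ha, hpos⟩
    -- For empty `I` the vector may be zero, and then it cannot be normalized.
    rcases I.eq_empty_or_nonempty with rfl | ⟨i₀, hi₀⟩
    · exact (constellationComplex X).empty_mem
    obtain ⟨w, hw⟩ := e.surjective ⟨a, ha⟩
    have hw' : ∀ i, a i = s i * inner ℝ (X i) w := fun i => by rw [← he, hw]
    have hw0 : w ≠ 0 := by
      rintro rfl
      simpa [hw'] using hpos i₀ hi₀
    refine ⟨NormedSpace.normalize w, Set.mem_iInter₂.mpr fun i hi => ⟨?_, ?_⟩⟩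
    · rw [mem_sphere_zero_iff_norm]
      exact NormedSpace.norm_normalize hw0
    · rw [NormedSpace.normalize, real_inner_smul_right]
      have := hpos i hi
      rw [hw'] at this
      exact mul_pos (inv_pos.mpr (norm_pos_iff.mpr hw0)) ((mul_pos_iff_of_pos_left (hs i)).mp this)

/-- A unit vector `w` lies in `H(X j)` iff the `j`-th coordinate of its image in `A` is positive. -/
theorem isGood_iff (h : Represents X A) :
    IsGood X ↔ ∀ a ∈ A, ∀ i, (∀ j ≠ i, a j ≤ 0) → a = 0 := by
  obtain ⟨s, hs, e, he⟩ := h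
  constructor
  · intro hX a ha i hi
    by_contra hne
    obtain ⟨w, hw⟩ := e.surjective ⟨a, ha⟩
    have hw0 : w ≠ 0 := by
      rintro rfl
      rw [map_zero] at hw
      exact hne (congrArg Subtype.val hw).symm
    have hw' : ∀ i, a i = s i * inner ℝ (X i) w := fun i => by rw [← he, hw]
    have h2 := hX (NormedSpace.normalize w) (by
      rw [mem_sphere_zero_iff_norm]; exact NormedSpace.norm_normalize hw0)
    have hsub : {j | NormedSpace.normalize w ∈ hemisphere (X j)} ⊆ {i} := by
      rintro j ⟨-, hj⟩
      by_contra hji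
      have h3 := hi j hji
      rw [hw'] at h3
      rw [NormedSpace.normalize, real_inner_smul_right] at hj
      have h4 := (mul_pos_iff_of_pos_left (inv_pos.mpr (norm_pos_iff.mpr hw0))).mp hj
      linarith [mul_pos (hs j) h4]
    have := Set.ncard_le_ncard hsub
    rw [Set.ncard_singleton] at this
    omega
  · intro hX w hw
    by_contra hlt
    have hw0 : w ≠ 0 := by
      rintro rfl
      simp at hw
    have hpos : ∀ j, w ∈ hemisphere (X j) ↔ 0 < (e w : Fin m → ℝ) j := fun j => by
      rw [he, mul_pos_iff_of_pos_left (hs j)]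
      exact and_iff_right hw
    have hle : {j | w ∈ hemisphere (X j)}.ncard ≤ 1 := by omega
    have hne : (e w : Fin m → ℝ) ≠ 0 := fun h0 =>
      hw0 (e.map_eq_zero_iff.mp (Subtype.ext h0))
    have hle' : ∀ i j, _ → _ → i = j := fun i j hi hj =>
      (Set.ncard_le_one_iff (Set.toFinite _)).mp hle hi hj
    simp only [Set.mem_ofPred_eq, hpos] at hle'
    apply hne
    by_cases hex : ∃ i, 0 < (e w : Fin m → ℝ) i
    · obtain ⟨i, hi⟩ := hex
      exact hX _ (e w).2 i fun j hj => not_lt.mp fun hjp => hj (hle' j i hjp hi)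
    · push Not at hex
      obtain ⟨i, -⟩ := Function.ne_iff.mp hne
      exact hX _ (e w).2 i fun j _ => hex j

/-- The hull of finitely many points is closed, so if it misses 0, a strictly separating functional
provides `w` with positive inner products on `J`. -/
theorem zero_mem_convexHull_iff (h : Represents X A) {J : Set (Fin m)} :
    0 ∈ convexHull ℝ (X '' J) ↔ ¬ ∃ a ∈ A, ∀ i ∈ J, 0 < a i := by
  obtain ⟨s, hs, e, he⟩ := h
  rw [← not_iff_not, not_not]
  constructor
  · intro h0
    obtain ⟨f, u, hu, hf⟩ := geometric_hahn_banach_point_closed (convex_convexHull ℝ (X '' J))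
      (((Set.toFinite J).image X).isClosed_convexHull ℝ) h0
    refine ⟨e ((InnerProductSpace.toDual ℝ _).symm f), (e _).2, fun i hi => ?_⟩
    rw [he, real_inner_comm, InnerProductSpace.toDual_symm_apply]
    refine mul_pos (hs i) ?_
    rw [map_zero] at hu
    exact hu.trans (hf _ (subset_convexHull ℝ _ (Set.mem_image_of_mem X hi)))
  · rintro ⟨a, ha, hpos⟩ h0
    obtain ⟨w, hw⟩ := e.surjective ⟨a, ha⟩
    have hsub : convexHull ℝ (X '' J) ⊆ {x | 0 < innerₗ _ w x} := by
      refine convexHull_min ?_ (convex_halfSpace_gt (innerₗ _ w).isLinear 0)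
      rintro _ ⟨i, hi, rfl⟩
      have := hpos i hi
      rw [show a i = s i * inner ℝ (X i) w by rw [← he, hw], mul_pos_iff_of_pos_left (hs i),
        real_inner_comm] at this
      exact this
    simpa using hsub h0

/-- The vectors orthogonal to all `X i`, `i ∈ J`, parametrize the elements of `A` vanishing on `J`.
-/
theorem span_eq_top_iff (h : Represents X A) {J : Set (Fin m)} :
    Submodule.span ℝ (X '' J) = ⊤ ↔ ∀ a ∈ A, (∀ i ∈ J, a i = 0) → a = 0 := by
  obtain ⟨s, hs, e, he⟩ := h
  have hmem : ∀ w, w ∈ (Submodule.span ℝ (X '' J))ᗮ ↔ ∀ i ∈ J, (e w : Fin m → ℝ) i = 0 := by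
    intro w
    simp only [he, mul_eq_zero, (hs _).ne', false_or]
    rw [← Submodule.span_singleton_le_iff_mem, ← Submodule.isOrtho_iff_le, Submodule.isOrtho_comm,
      Submodule.isOrtho_span]
    simp
  rw [← Submodule.orthogonal_eq_bot_iff, Submodule.eq_bot_iff]
  constructor
  · intro h a ha hz
    obtain ⟨w, hw⟩ := e.surjective ⟨a, ha⟩
    have hw0 := h w ((hmem w).mpr (by rwa [hw]))
    rw [hw0, map_zero] at hw
    exact (congrArg Subtype.val hw).symm
  · intro h w hw
    exact e.map_eq_zero_iff.mp (Subtype.ext (h _ (e w).2 ((hmem w).mp hw)))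

theorem isNondegenerate_iff (h : Represents X A) :
    IsNondegenerate X ↔ ∀ J : Finset (Fin m), J ∉ (constellationComplex X).faces →
      ∀ a ∈ A, (∀ i ∈ J, a i = 0) → a = 0 := by
  simp only [IsNondegenerate, h.zero_mem_convexHull_iff, h.span_eq_top_iff,
    h.mem_constellationComplex_iff]
  refine ⟨fun H J => by simpa using H J, fun H J => ?_⟩
  simpa using H (Set.toFinite J).toFinset

end Represents

/-- Each good configuration represents the affine dependences of some affinely spanning points. -/
theorem IsGood.exists_represents {X : Fin m → EuclideanSpace ℝ (Fin n)} (hX : IsGood X)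
    (hm : d + 1 + n = m) : ∃ y : Fin m → EuclideanSpace ℝ (Fin d),
      Represents X (affineDependences y) ∧ Function.Injective (affineEval y) := by
  have hpos : ∀ w : EuclideanSpace ℝ (Fin n), w ≠ 0 → ∃ i, 0 < inner ℝ (X i) w := by
    intro w hw
    have h2 := hX (NormedSpace.normalize w) (by
      rw [mem_sphere_zero_iff_norm]; exact NormedSpace.norm_normalize hw)
    obtain ⟨i, -, hi⟩ := Set.nonempty_of_ncard_ne_zero (by omega :
      {i | NormedSpace.normalize w ∈ hemisphere (X i)}.ncard ≠ 0)
    rw [NormedSpace.normalize, real_inner_smul_right] at hi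
    exact ⟨i, (mul_pos_iff_of_pos_left (inv_pos.mpr (norm_pos_iff.mpr hw))).mp hi⟩
  let L : EuclideanSpace ℝ (Fin n) →ₗ[ℝ] (Fin m → ℝ) := LinearMap.pi fun i => innerₗ _ (X i)
  -- If all `⟪X i, w⟫ ≥ 0` with `w ≠ 0`, then `-w` lies in no open hemisphere, against goodness.
  -- Hence there is a positive relation `∑ s i • X i = 0`.
  obtain ⟨s, hs, hs0, -⟩ := exists_pos_mem_perp (LinearMap.range L) Set.univ (by
    rintro _ ⟨w, rfl⟩ hw i -
    have hw0 : w = 0 := by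
      by_contra hne
      obtain ⟨j, hj⟩ := hpos (-w) (neg_ne_zero.mpr hne)
      have : 0 ≤ inner ℝ (X j) w := hw j trivial
      rw [inner_neg_right] at hj
      linarith
    rw [hw0, map_zero, Pi.zero_apply])
  replace hs0 : ∀ i, 0 < s i := fun i => hs0 i trivial
  let M : EuclideanSpace ℝ (Fin n) →ₗ[ℝ] (Fin m → ℝ) :=
    LinearMap.pi fun i => s i • innerₗ _ (X i)
  have hM : ∀ w i, M w i = s i * inner ℝ (X i) w := fun w i => rfl
  have hMinj : Function.Injective M := by
    rw [injective_iff_map_eq_zero]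
    intro w hw
    by_contra hne
    obtain ⟨i, hi⟩ := hpos w hne
    exact (mul_pos (hs0 i) hi).ne' (congrFun hw i)
  set u : Fin m → ℝ := fun _ => 1 with hu
  have hone : u ∈ perp (LinearMap.range M) := by
    rw [mem_perp] at hs ⊢
    rintro _ ⟨w, rfl⟩
    have := hs _ (LinearMap.mem_range_self L w)
    rw [← this]
    exact Finset.sum_congr rfl fun i _ => by rw [hu, mul_one, hM, mul_comm]; rfl
  have hm0 : 0 < m := by omega
  have hu0 : u ≠ 0 := fun h => one_ne_zero (congrFun h ⟨0, hm0⟩)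
  have hspan : Submodule.span ℝ {u} ≤ perp (LinearMap.range M) := by
    rwa [Submodule.span_singleton_le_iff_mem]
  -- The complement of `range M` has dimension `d + 1` and contains the constants; a basis of a
  -- `d`-dimensional supplement `W` to them serves as coordinate functions of the points.
  obtain ⟨Q, hQ⟩ := Submodule.exists_isCompl (Submodule.span ℝ {u})
  set W := Q ⊓ perp (LinearMap.range M) with hW
  have hsup : Submodule.span ℝ {u} ⊔ W = perp (LinearMap.range M) := by
    rw [hW, ← sup_inf_assoc_of_le _ hspan, hQ.sup_eq_top, top_inf_eq]
  have hinf : Submodule.span ℝ {u} ⊓ W = ⊥ := by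
    rw [hW, ← inf_assoc, hQ.inf_eq_bot, bot_inf_eq]
  have hfin : Module.finrank ℝ (perp (LinearMap.range M)) = d + 1 := by
    have := finrank_add_finrank_perp (LinearMap.range M)
    rw [LinearMap.finrank_range_of_inj hMinj, finrank_euclideanSpace_fin, Fintype.card_fin] at this
    omega
  have hfinW : Module.finrank ℝ W = d := by
    have := Submodule.finrank_sup_add_finrank_inf_eq (Submodule.span ℝ {u}) W
    rw [hsup, hinf, finrank_bot, finrank_span_singleton hu0, hfin] at this
    omega
  let b := Module.finBasisOfFinrankEq ℝ W hfinW
  let y : Fin m → EuclideanSpace ℝ (Fin d) := fun i =>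
    WithLp.toLp 2 fun j => (b j : Fin m → ℝ) i
  have hy : ∀ p, affineEval y p = ((∑ j, p.1 j • b j : W) : Fin m → ℝ) + p.2 • u := by
    intro p
    ext i
    simp [y, PiLp.inner_apply, mul_comm, hu]
  have hrange : LinearMap.range (affineEval y) = perp (LinearMap.range M) := by
    apply le_antisymm
    · rintro _ ⟨p, rfl⟩
      rw [hy, ← hsup, add_comm]
      exact Submodule.add_mem_sup (Submodule.smul_mem _ _ (Submodule.mem_span_singleton_self u))
        (Subtype.prop _)
    · rw [← hsup, sup_le_iff, Submodule.span_singleton_le_iff_mem]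
      refine ⟨const_mem_range_affineEval y, fun w hw => ?_⟩
      refine ⟨(WithLp.toLp 2 (b.equivFun ⟨w, hw⟩), 0), ?_⟩
      rw [hy]
      simp [b.sum_equivFun, -Module.Basis.equivFun_apply]
  refine ⟨y, ?_, ?_⟩
  · rw [← perp_range_affineEval, hrange, perp_perp]
    exact ⟨s, hs0, LinearEquiv.ofInjective M hMinj, fun w i => rfl⟩
  -- The range already has the full dimension `d + 1` of the domain.
  · have := LinearMap.finrank_range_add_finrank_ker (affineEval y)
    rw [hrange, hfin] at this
    simp only [Module.finrank_prod, finrank_euclideanSpace_fin, Module.finrank_self] at this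
    exact LinearMap.ker_eq_bot.mp (Submodule.finrank_eq_zero.mp (by omega))

end GaleDiagrams

/-! ### Relabelling, Alexander duality and the two characterizations. -/

section MainTheorem

variable {d m n : ℕ}

theorem IsConfiguration.comp {X : Fin m → EuclideanSpace ℝ (Fin n)} (hX : IsConfiguration X)
    (σ : Equiv.Perm (Fin m)) : IsConfiguration (X ∘ σ) := fun i => hX (σ i)

theorem IsGood.comp {X : Fin m → EuclideanSpace ℝ (Fin n)} (hX : IsGood X)
    (σ : Equiv.Perm (Fin m)) : IsGood (X ∘ σ) := by
  intro w hw
  have h : {j | w ∈ hemisphere (X j)} = σ '' {i | w ∈ hemisphere ((X ∘ σ) i)} := by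
    ext j
    exact ⟨fun hj => ⟨σ.symm j, by simpa using hj, by simp⟩, by rintro ⟨i, hi, rfl⟩; exact hi⟩
  rw [← Set.ncard_image_of_injective _ σ.injective, ← h]
  exact hX w hw

theorem IsNondegenerate.comp {X : Fin m → EuclideanSpace ℝ (Fin n)} (hX : IsNondegenerate X)
    (σ : Equiv.Perm (Fin m)) : IsNondegenerate (X ∘ σ) := by
  intro J
  rw [Set.image_comp]
  exact hX _

theorem mem_constellationComplex_comp {X : Fin m → EuclideanSpace ℝ (Fin n)}
    (σ : Equiv.Perm (Fin m)) {I : Finset (Fin m)} :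
    I ∈ (constellationComplex (X ∘ σ)).faces ↔
      I.map σ.toEmbedding ∈ (constellationComplex X).faces := by
  refine exists_congr fun x => ?_
  rw [Set.mem_iInter₂, Set.mem_iInter₂, Finset.forall_mem_map]
  rfl

/-- In a nondegenerate configuration only the points of `ℝ^0` may be zero. -/
theorem IsNondegenerate.ne_zero {X : Fin m → EuclideanSpace ℝ (Fin n)} (hX : IsNondegenerate X)
    (hn : 0 < n) (i : Fin m) : X i ≠ 0 := by
  intro h0
  have h := hX {i} (by simp [h0])
  rw [Set.image_singleton, h0, Submodule.span_singleton_eq_bot.mpr rfl] at h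
  have := congrArg (fun S : Submodule ℝ (EuclideanSpace ℝ (Fin n)) => Module.finrank ℝ S) h
  simp at this
  omega

namespace LabeledPolytope

variable (P : LabeledPolytope d m)

theorem finrank_affineDependences_add : d + 1 + Module.finrank ℝ (affineDependences P.vertex) = m :=
  finrank_affineDependences P.injective_affineEval

theorem exists_isGaleDiagram :
    ∃ G : Fin m → EuclideanSpace ℝ (Fin (m - 1 - d)), IsGaleDiagram P.vertex G :=
  _root_.exists_isGaleDiagram (by have := P.finrank_affineDependences_add; omega)

variable {P} {G : Fin m → EuclideanSpace ℝ (Fin n)}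

/-- Alexander duality itself: both sides deny that some dependence is positive on `I`. -/
theorem compl_mem_nerveComplex_iff (hG : Represents G (affineDependences P.vertex))
    {I : Finset (Fin m)} :
    Iᶜ ∈ P.nerveComplex.faces ↔ I ∉ (constellationComplex G).faces := by
  rw [P.mem_nerveComplex_iff, hG.mem_constellationComplex_iff]
  simp

theorem isGood_of_represents (hG : Represents G (affineDependences P.vertex)) : IsGood G :=
  hG.isGood_iff.mpr fun _ ha _ hi => P.eq_zero_of_nonpos ha hi

/-- Dependences supported on a simplex of the nerve are those vanishing on its complement, a nonface
of `Δ(G)`. -/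
theorem isSimplicial_iff_isNondegenerate (hG : Represents G (affineDependences P.vertex)) :
    P.IsSimplicial ↔ IsNondegenerate G := by
  rw [P.isSimplicial_iff, hG.isNondegenerate_iff]
  constructor
  · intro h J hJ a ha hz
    exact h Jᶜ ((compl_mem_nerveComplex_iff hG).mpr hJ) a ha fun i hi => hz i (by simpa using hi)
  · intro h I hI a ha hz
    rw [← compl_compl I, compl_mem_nerveComplex_iff hG] at hI
    exact h Iᶜ hI a ha fun i hi => hz i (by simpa using hi)

theorem dual_eq_constellationComplex (hG : Represents G (affineDependences P.vertex))
    {K : LabelComplex m} (hK : Finset.univ ∉ K.faces) {σ : Equiv.Perm (Fin m)}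
    (hσ : IsFaceIso σ K.faces P.nerveComplex.faces) :
    K.dual hK = constellationComplex (G ∘ σ) := by
  ext I
  have h : Iᶜ.map σ.toEmbedding = (I.map σ.toEmbedding)ᶜ := by
    ext j
    simp
  rw [mem_constellationComplex_comp, ← not_iff_not, ← compl_mem_nerveComplex_iff hG, ← h,
    ← hσ Iᶜ]
  exact not_not

end LabeledPolytope

/-- A good configuration is a Gale diagram of a polytope. -/
theorem IsGood.exists_labeledPolytope {X : Fin m → EuclideanSpace ℝ (Fin n)} (hX : IsGood X)
    (hm : d + 1 + n = m) :
    ∃ P : LabeledPolytope d m, Represents X (affineDependences P.vertex) := by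
  obtain ⟨y, hy, hinj⟩ := hX.exists_represents hm
  obtain ⟨h1, h2⟩ := (injective_and_range_eq_extremePoints_iff y).mpr (hy.isGood_iff.mp hX)
  exact ⟨⟨y, h1, h2, (injective_affineEval_iff y).mp hinj⟩, hy⟩

theorem LabeledPolytope.eq_nerveComplex {P : LabeledPolytope d m}
    {X : Fin m → EuclideanSpace ℝ (Fin n)} (hX : Represents X (affineDependences P.vertex))
    {K : LabelComplex m} {hK : Finset.univ ∉ K.faces} (h : K.dual hK = constellationComplex X) :
    K = P.nerveComplex := by
  ext I
  rw [← compl_compl I, compl_mem_nerveComplex_iff hX, ← h]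
  exact not_not.symm

theorem isFaceIso_one (A : Set (Finset (Fin m))) : IsFaceIso 1 A A := fun I => by
  rw [show (1 : Equiv.Perm (Fin m)).toEmbedding = Function.Embedding.refl _ from rfl,
    Finset.map_refl]

end MainTheorem

theorem mainTheorem2 (m d : ℕ) (K : LabelComplex m) (hK : Finset.univ ∉ K.faces) :
    -- Part 1: `K` is isomorphic to the nerve-complex of a `d`-polytope iff its Alexander dual is
    -- a constellation complex of a good configuration on `𝕊^(m-2-d) ⊔ {0}`.
    ((∃ P : LabeledPolytope d m, ∃ σ, IsFaceIso σ K.faces P.nerveComplex.faces) ↔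
      d + 1 ≤ m ∧ ∃ X : Fin m → EuclideanSpace ℝ (Fin (m - 1 - d)),
        IsConfiguration X ∧ IsGood X ∧ K.dual hK = constellationComplex X) ∧
    -- For every such polytope, its Gale diagrams exist and every one of them is such an `X`.
    (∀ (P : LabeledPolytope d m) (σ : Equiv.Perm (Fin m)),
      IsFaceIso σ K.faces P.nerveComplex.faces →
      (∃ G : Fin m → EuclideanSpace ℝ (Fin (m - 1 - d)), IsGaleDiagram P.vertex G) ∧
      ∀ G : Fin m → EuclideanSpace ℝ (Fin (m - 1 - d)), IsGaleDiagram P.vertex G →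
        IsConfiguration (G ∘ σ) ∧ IsGood (G ∘ σ) ∧
          K.dual hK = constellationComplex (G ∘ σ)) ∧
    -- Conversely, every such `X` is a Gale diagram of a polytope whose nerve-complex is `K`.
    (d + 1 ≤ m → ∀ X : Fin m → EuclideanSpace ℝ (Fin (m - 1 - d)),
      IsConfiguration X → IsGood X → K.dual hK = constellationComplex X →
      ∃ P : LabeledPolytope d m, IsGaleDiagram P.vertex X ∧ K = P.nerveComplex) ∧
    -- Part 2: `K` is the boundary of a simplicial `d`-polytope iff `X` can moreover be taken
    -- nondegenerate; it lies on the sphere `𝕊^(m-2-d)` unless that sphere is empty.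
    ((∃ P : LabeledPolytope d m, P.IsSimplicial ∧ ∃ σ, IsFaceIso σ K.faces P.boundaryFaces) ↔
      d + 1 ≤ m ∧ ∃ X : Fin m → EuclideanSpace ℝ (Fin (m - 1 - d)),
        IsConfiguration X ∧
        (d + 2 ≤ m → ∀ i, X i ∈ Metric.sphere (0 : EuclideanSpace ℝ (Fin (m - 1 - d))) 1) ∧
        IsGood X ∧ IsNondegenerate X ∧ K.dual hK = constellationComplex X) := by
  have fwd : ∀ (P : LabeledPolytope d m) (σ : Equiv.Perm (Fin m)),
      IsFaceIso σ K.faces P.nerveComplex.faces →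
      ∀ G : Fin m → EuclideanSpace ℝ (Fin (m - 1 - d)), IsGaleDiagram P.vertex G →
        IsConfiguration (G ∘ σ) ∧ IsGood (G ∘ σ) ∧
          K.dual hK = constellationComplex (G ∘ σ) := by
    intro P σ hσ G hG
    obtain ⟨hc, hr⟩ := isGaleDiagram_iff.mp hG
    exact ⟨hc.comp σ, (LabeledPolytope.isGood_of_represents hr).comp σ,
      LabeledPolytope.dual_eq_constellationComplex hr hK hσ⟩
  have bwd : d + 1 ≤ m → ∀ X : Fin m → EuclideanSpace ℝ (Fin (m - 1 - d)),
      IsGood X → K.dual hK = constellationComplex X →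
      ∃ P : LabeledPolytope d m, Represents X (affineDependences P.vertex) ∧
        K = P.nerveComplex := by
    intro hm X hX hdual
    obtain ⟨P, hP⟩ := hX.exists_labeledPolytope (d := d) (by omega)
    exact ⟨P, hP, LabeledPolytope.eq_nerveComplex hP hdual⟩
  refine ⟨⟨?_, ?_⟩, fun P σ hσ => ⟨P.exists_isGaleDiagram, fwd P σ hσ⟩, ?_, ?_, ?_⟩
  · rintro ⟨P, σ, hσ⟩
    obtain ⟨G, hG⟩ := P.exists_isGaleDiagram
    -- The dimension count `d + 1 + dim A = m` gives `d + 1 ≤ m`.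
    have := P.finrank_affineDependences_add
    exact ⟨by omega, G ∘ σ, fwd P σ hσ G hG⟩
  · rintro ⟨hm, X, -, hX, hdual⟩
    obtain ⟨P, -, rfl⟩ := bwd hm X hX hdual
    exact ⟨P, 1, isFaceIso_one _⟩
  · intro hm X hc hX hdual
    obtain ⟨P, hP, hKP⟩ := bwd hm X hX hdual
    exact ⟨P, isGaleDiagram_iff.mpr ⟨hc, hP⟩, hKP⟩
  · rintro ⟨P, hsimp, σ, hσ⟩
    rw [hsimp.boundaryFaces_eq] at hσ
    obtain ⟨G, hG⟩ := P.exists_isGaleDiagram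
    obtain ⟨hc, hgood, hdual⟩ := fwd P σ hσ G hG
    have hnd := (LabeledPolytope.isSimplicial_iff_isNondegenerate
      (isGaleDiagram_iff.mp hG).2).mp hsimp
    have := P.finrank_affineDependences_add
    exact ⟨by omega, G ∘ σ, hc,
      -- For `m ≥ d + 2` the ambient space has positive dimension, so nondegeneracy excludes zero
      -- points.
      fun hm i => (hc i).resolve_right (hnd.ne_zero (by omega) (σ i)),
      hgood, hnd.comp σ, hdual⟩
  · rintro ⟨hm, X, -, -, hX, hnd, hdual⟩
    obtain ⟨P, hP, rfl⟩ := bwd hm X hX hdual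
    have hsimp := (LabeledPolytope.isSimplicial_iff_isNondegenerate hP).mpr hnd
    exact ⟨P, hsimp, 1, hsimp.boundaryFaces_eq ▸ isFaceIso_one _⟩
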